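/- Let $k$ be a field, $A$ an associative unital $k$-algebra, $B$ a commutative unital $k$-algebra, and $\varepsilon:B\to A$ a homomorphism of unital $k$-algebras whose image lies in the centre of $A$. For $n\ge 0$ let $$C^n=C^n((A,B,\varepsilon);A)=\mathrm{Hom}_k\bigl(A^{\otimes n}\otimes B^{\otimes n(n-1)/2},A\bigr),$$ and $C^n=0$ for $n<0$. A pure tensor $T$ in $A^{\otimes n}\otimes B^{\otimes n(n-1)/2}$ is written as an upper triangular matrix with diagonal entries $a_1,\dots,a_n\in A$ and entries $b_{i,j}\in B$ for $1\le i<j\le n$. For such $T$, let $T^i_{j}$ denote the submatrix on the rows and columns $i+1,\dots,j$. For a matrix $T$ of size $N=m+n-1$, an integer $0\le i\le m-1$ and $x\in A$, let $T[i,n;x]$ be the matrix of size $m$ obtained by merging the $n$ consecutive indices $i+1,\dots,i+n$ into a single index in position $i+1$: its diagonal is $a_1,\dots,a_i,x,a_{i+n+1},\dots,a_N$, and each of its entries above the diagonal is the product of all entries $b_{u,v}$ of $T$ for which $u$ belongs to its row and $v$ to its column after merging (the empty product, which occurs for $n=0$, is $1$). For $m,n\ge 0$, $f\in C^m$ and $g\in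 C^n$ put $$(f\circ_i g)(T)=f\bigl(T[i,n;g(T^i_{i+n})]\bigr)\quad(0\le i\le m-1),\qquad f\circ g=\sum_{i=0}^{m-1}(-1)^{(n-1)i}f\circ_i g\in C^{m+n-1},$$ $$(f\smile g)(T)=f(T^0_m)\prod_{1\le i\le m<j\le m+n}\varepsilon(b_{i,j})\;g(T^m_{m+n}),\qquad f\smile g\in C^{m+n},$$ and define $\delta^\varepsilon:C^n\to C^{n+1}$ for $n\ge 0$ by the following formula (in negative degrees all operations are zero): $$\delta^\varepsilon(f)(T)=a_1\,\varepsilon\Bigl(\prod_{j=2}^{n+1}b_{1,j}\Bigr)f(T^1_{n+1})+\sum_{i=1}^{n}(-1)^i f\bigl(T[i-1,2;\varepsilon(b_{i,i+1})a_ia_{i+1}]\bigr)+(-1)^{n+1}f(T^0_n)\,a_{n+1}\,\varepsilon\Bigl(\prod_{i=1}^{n}b_{i,n+1}\Bigr).$$ **Theorem.** For all integers $m,n$ and all $f\in C^m$, $g\in C^n$, the following identity holds in $C^{m+n}$: $$f\circ\delta^{\varepsilon}g-\delta^{\varepsilon}(f\circ g)+(-1)^{n-1}\,\delta^{\varepsilon}f\circ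 g=(-1)^{n-1}\bigl(g\smile f-(-1)^{mn}f\smile g\bigr).$$ -/

import Mathlib

open scoped TensorProduct

set_option linter.unusedSectionVars false

namespace SecondaryHochschild

section Matrices

/-- The positions `(i, j)`, `i < j`, above the diagonal of an `n × n` matrix; there are
`n (n - 1) / 2` of them. Indices start at `0`. -/
abbrev Pair (n : ℕ) : Type := {p : Fin n × Fin n // p.1 < p.2}

variable {A B : Type*} {m n N : ℕ}

/-- The inclusion of the `n` consecutive indices `i, …, i + n - 1` into `Fin N`. -/
def window (i n : ℕ) (h : i + n ≤ N) (j : Fin n) : Fin N := ⟨i + j, by omega⟩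

/-- The induced inclusion of the positions above the diagonal. -/
def windowPair (i n : ℕ) (h : i + n ≤ N) (P : Pair n) : Pair N :=
  ⟨(window i n h P.1.1, window i n h P.1.2), by
    have := P.2; simp only [window, Fin.lt_def] at *; omega⟩

/-- For `N = m + n - 1`: the monotone map `Fin N → Fin m` that collapses the `n` consecutive
indices `i, …, i + n - 1` to the single index `i` (if `n = 0`, it skips the index `i`). -/
def collapse (h : N + 1 = m + n) (i : Fin m) (t : Fin N) : Fin m :=
  ⟨if (t : ℕ) < i then t else if (t : ℕ) < i + n then i else t + 1 - n, by
    have := i.2; have := t.2; split_ifs <;> omega⟩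

/-- The diagonal of the matrix in which the diagonal entries `i, …, i + n - 1` are
replaced by the single entry `x`: `(a_0, …, a_{i-1}, x, a_{i+n}, …, a_{N-1})`. -/
def mergeA (h : N + 1 = m + n) (i : Fin m) (x : A) (a : Fin N → A) (s : Fin m) : A :=
  if h₁ : s < i then a ⟨s, by have := i.2; simp only [Fin.lt_def] at h₁; omega⟩
  else if h₂ : s = i then x
  else a ⟨s - 1 + n, by
    have := s.2; have := i.2; simp only [Fin.lt_def, Fin.ext_iff] at h₁ h₂; omega⟩

/-- The entries above the diagonal after the rows (and the columns) `i, …, i + n - 1` are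
merged into one by multiplication: the entry at `(s, t)` is the product of all `b_{u,v}` with `u`
collapsed to `s` and `v` collapsed to `t`. -/
def mergeB [CommMonoid B] (h : N + 1 = m + n) (i : Fin m) (b : Pair N → B) (Q : Pair m) : B :=
  ∏ P : Pair N with collapse h i P.1.1 = Q.1.1 ∧ collapse h i P.1.2 = Q.1.2, b P

end Matrices

section Cochains

variable (k A B : Type*) [Field k] [Ring A] [Algebra k A] [CommRing B] [Algebra k B]

/-- `A^{⊗ n} ⊗ B^{⊗ n(n-1)/2}`. -/
abbrev TensorMatrix (n : ℕ) : Type _ :=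
  (⨂[k] _ : Fin n, A) ⊗[k] (⨂[k] _ : Pair n, B)

/-- `C^n((A,B,ε);A) = Hom_k(A^{⊗ n} ⊗ B^{⊗ n(n-1)/2}, A)` for `n ≥ 0`. -/
abbrev Coch (n : ℕ) : Type _ := TensorMatrix k A B n →ₗ[k] A

variable {k A B} {m n N : ℕ}

/-- The value of a cochain at the tensor matrix with diagonal `a` and upper entries `b`. -/
def Coch.eval (f : Coch k A B n) (a : Fin n → A) (b : Pair n → B) : A :=
  f (PiTensorProduct.tprod k a ⊗ₜ[k] PiTensorProduct.tprod k b)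

variable (k) in
/-- Linearity of a function of the entries of a matrix in each entry separately. -/
structure SepLin (F : (Fin n → A) → (Pair n → B) → A) : Prop where
  left : ∀ a b j, IsLinearMap k fun x => F (Function.update a j x) b
  right : ∀ a b P, IsLinearMap k fun y => F a (Function.update b P y)

/-- The cochain with prescribed values on the pure tensors. -/
noncomputable def Coch.mk (F : (Fin n → A) → (Pair n → B) → A) (hF : SepLin k F) :
    Coch k A B n :=
  TensorProduct.lift <| PiTensorProduct.lift
    { toFun := fun a => PiTensorProduct.lift
        { toFun := fun b => F a b
          map_update_add' := by
            intro _ b P x y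
            convert (hF.right a b P).map_add x y
          map_update_smul' := by
            intro _ b P c x
            convert (hF.right a b P).map_smul c x }
      map_update_add' := by
        intro _ a j x y
        ext b
        simp only [LinearMap.compMultilinearMap_apply, PiTensorProduct.lift.tprod,
          MultilinearMap.coe_mk, LinearMap.add_apply]
        convert (hF.left a b j).map_add x y
      map_update_smul' := by
        intro _ a j c x
        ext b
        simp only [LinearMap.compMultilinearMap_apply, PiTensorProduct.lift.tprod,
          MultilinearMap.coe_mk, LinearMap.smul_apply]
        convert (hF.left a b j).map_smul c x }

@[simp]
theorem Coch.eval_mk (F : (Fin n → A) → (Pair n → B) → A) (hF : SepLin k F)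
    (a : Fin n → A) (b : Pair n → B) : (Coch.mk F hF).eval a b = F a b := by
  simp [Coch.mk, Coch.eval]

theorem Coch.eval_sepLin (f : Coch k A B n) : SepLin k f.eval where
  left a b j := ⟨fun x y => by simp [Coch.eval, TensorProduct.add_tmul],
    fun c x => by
      simp only [Coch.eval, MultilinearMap.map_update_smul, ← TensorProduct.smul_tmul', map_smul]⟩
  right a b P := ⟨fun x y => by simp [Coch.eval, TensorProduct.tmul_add],
    fun c x => by simp [Coch.eval]⟩

theorem window_injective (i n : ℕ) (h : i + n ≤ N) : Function.Injective (window i n h) := by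
  intro x y hxy
  simp only [window, Fin.mk.injEq] at hxy
  exact Fin.ext (by omega)

theorem windowPair_injective (i n : ℕ) (h : i + n ≤ N) :
    Function.Injective (windowPair i n h) := by
  rintro ⟨⟨x, y⟩, _⟩ ⟨⟨x', y'⟩, _⟩ hxy
  simp only [windowPair, Subtype.mk.injEq, Prod.mk.injEq] at hxy ⊢
  exact ⟨window_injective i n h hxy.1, window_injective i n h hxy.2⟩

theorem mem_range_window {i n : ℕ} {h : i + n ≤ N} {j : Fin N} :
    j ∈ Set.range (window i n h) ↔ i ≤ j ∧ (j : ℕ) < i + n := by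
  constructor
  · rintro ⟨t, rfl⟩
    have := t.2
    simp only [window]
    omega
  · rintro ⟨h₁, h₂⟩
    exact ⟨⟨j - i, by omega⟩, Fin.ext (by simp only [window]; omega)⟩

theorem mem_range_windowPair {i n : ℕ} {h : i + n ≤ N} {P : Pair N} :
    P ∈ Set.range (windowPair i n h) ↔ i ≤ P.1.1 ∧ (P.1.2 : ℕ) < i + n := by
  constructor
  · rintro ⟨t, rfl⟩
    have := t.1.2.2
    simp only [windowPair, window]
    omega
  · rintro ⟨h₁, h₂⟩
    have h₃ : (P.1.1 : ℕ) < P.1.2 := P.2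
    refine ⟨⟨(⟨P.1.1 - i, by omega⟩, ⟨P.1.2 - i, by omega⟩), ?_⟩, ?_⟩
    · simp only [Fin.lt_def]; omega
    · refine Subtype.ext (Prod.ext (Fin.ext ?_) (Fin.ext ?_)) <;>
        simp only [windowPair, window] <;> omega

theorem mergeA_eq_update (h : N + 1 = m + n) (i : Fin m) (x : A) (a : Fin N → A) :
    mergeA h i x a = Function.update (mergeA h i 0 a) i x := by
  funext s
  by_cases hs : s = i
  · subst hs; simp [mergeA]
  · simp [mergeA, hs]

theorem mergeA_update_of_mem (h : N + 1 = m + n) (i : Fin m) (x y : A) (a : Fin N → A)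
    (j : Fin N) (hj : i ≤ (j : ℕ) ∧ (j : ℕ) < i + n) :
    mergeA h i x (Function.update a j y) = mergeA h i x a := by
  funext s
  simp only [mergeA]
  split_ifs with h₁ h₂
  · rw [Function.update_of_ne]
    simp only [ne_eq, Fin.ext_iff] at *
    omega
  · rfl
  · rw [Function.update_of_ne]
    simp only [ne_eq, Fin.ext_iff] at *
    omega

theorem mergeA_update_of_notMem (h : N + 1 = m + n) (i : Fin m) (x y : A) (a : Fin N → A)
    (j : Fin N) (hj : ¬ (i ≤ (j : ℕ) ∧ (j : ℕ) < i + n)) :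
    mergeA h i x (Function.update a j y) =
      Function.update (mergeA h i x a) (collapse h i j) y := by
  funext s
  simp only [mergeA, Function.update_apply, collapse, Fin.lt_def, Fin.ext_iff]
  have := s.2
  have := j.2
  split_ifs <;> first | rfl | omega

theorem mergeB_update_of_mem (h : N + 1 = m + n) (i : Fin m) (y : B) (b : Pair N → B)
    (P : Pair N) (hP : i ≤ (P.1.1 : ℕ) ∧ (P.1.2 : ℕ) < i + n) :
    mergeB h i (Function.update b P y) = mergeB h i b := by
  funext Q
  refine Finset.prod_congr rfl fun R hR => ?_
  rw [Function.update_of_ne]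
  rintro rfl
  have h₁ : (R.1.1 : ℕ) < R.1.2 := R.2
  have h₂ : (Q.1.1 : ℕ) < Q.1.2 := Q.2
  simp only [Finset.mem_filter, Finset.mem_univ, true_and, collapse, Fin.ext_iff] at hR
  obtain ⟨h₃, h₄⟩ := hR
  split_ifs at h₃ h₄ <;> omega

theorem mergeB_update_of_notMem (h : N + 1 = m + n) (i : Fin m) (b : Pair N → B)
    (P : Pair N) (hP : ¬ (i ≤ (P.1.1 : ℕ) ∧ (P.1.2 : ℕ) < i + n)) :
    ∃ (Q : Pair m) (c : B), ∀ y,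
      mergeB h i (Function.update b P y) = Function.update (mergeB h i b) Q (y * c) := by
  have h₁ : (P.1.1 : ℕ) < P.1.2 := P.2
  have hlt : collapse h i P.1.1 < collapse h i P.1.2 := by
    simp only [collapse, Fin.lt_def]
    split_ifs <;> omega
  refine ⟨⟨(collapse h i P.1.1, collapse h i P.1.2), hlt⟩,
    ∏ R ∈ (Finset.univ.filter fun R : Pair N => collapse h i R.1.1 = collapse h i P.1.1 ∧
      collapse h i R.1.2 = collapse h i P.1.2).erase P, b R, fun y => ?_⟩
  funext Q
  by_cases hQ : Q = ⟨(collapse h i P.1.1, collapse h i P.1.2), hlt⟩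
  · subst hQ
    rw [Function.update_self, mergeB, ← Finset.mul_prod_erase _ _ (a := P) (by simp),
      Function.update_self]
    congr 1
    refine Finset.prod_congr rfl fun R hR => ?_
    rw [Function.update_of_ne (Finset.ne_of_mem_erase hR)]
  · rw [Function.update_of_ne hQ]
    refine Finset.prod_congr rfl fun R hR => ?_
    rw [Function.update_of_ne]
    rintro rfl
    simp only [Finset.mem_filter, Finset.mem_univ, true_and] at hR
    exact hQ (Subtype.ext (Prod.ext hR.1.symm hR.2.symm))

theorem SepLin.merge (h : N + 1 = m + n) (i : Fin m) (f : Coch k A B m) (g : Coch k A B n) :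
    SepLin k fun (a : Fin N → A) (b : Pair N → B) =>
      f.eval (mergeA h i (g.eval (a ∘ window i n (by omega)) (b ∘ windowPair i n (by omega))) a)
        (mergeB h i b) where
  left a b j := by
    have hw : (i : ℕ) + n ≤ N := by omega
    by_cases hj : i ≤ (j : ℕ) ∧ (j : ℕ) < i + n
    · obtain ⟨t, rfl⟩ := mem_range_window (h := hw) |>.2 hj
      simp only [mergeA_update_of_mem h i _ _ a _ hj,
        Function.update_comp_eq_of_injective _ (window_injective _ _ _)]
      have h₁ := g.eval_sepLin.left (a ∘ window i n (by omega)) (b ∘ windowPair i n (by omega)) t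
      have h₂ := f.eval_sepLin.left (mergeA h i 0 a) (mergeB h i b) i
      simp only [← mergeA_eq_update] at h₂
      exact ⟨fun x y => by rw [h₁.map_add, h₂.map_add], fun c x => by rw [h₁.map_smul, h₂.map_smul]⟩
    · simp only [mergeA_update_of_notMem h i _ _ a _ hj]
      have h₁ : ∀ x, Function.update a j x ∘ window i n (by omega) =
          a ∘ window (N := N) i n (by omega) := fun x =>
        Function.update_comp_eq_of_notMem_range _ _ fun hr => hj (mem_range_window.1 hr)
      simp only [h₁]
      exact f.eval_sepLin.left _ _ _
  right a b P := by
    have hw : (i : ℕ) + n ≤ N := by omega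
    by_cases hP : i ≤ (P.1.1 : ℕ) ∧ (P.1.2 : ℕ) < i + n
    · simp only [mergeB_update_of_mem h i _ b P hP]
      obtain ⟨t, rfl⟩ := mem_range_windowPair (h := hw) |>.2 hP
      simp only [Function.update_comp_eq_of_injective _ (windowPair_injective _ _ _)]
      have h₁ := g.eval_sepLin.right (a ∘ window i n (by omega)) (b ∘ windowPair i n (by omega)) t
      have h₂ := f.eval_sepLin.left (mergeA h i 0 a) (mergeB h i b) i
      simp only [← mergeA_eq_update] at h₂
      exact ⟨fun x y => by rw [h₁.map_add, h₂.map_add], fun c x => by rw [h₁.map_smul, h₂.map_smul]⟩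
    · have h₁ : ∀ y, Function.update b P y ∘ windowPair i n (by omega) =
          b ∘ windowPair (N := N) i n (by omega) := fun x =>
        Function.update_comp_eq_of_notMem_range _ _ fun hr => hP (mem_range_windowPair.1 hr)
      obtain ⟨Q, c, hQ⟩ := mergeB_update_of_notMem h i b P hP
      simp only [h₁, hQ]
      have h₂ := f.eval_sepLin.right (mergeA h i (g.eval (a ∘ window i n (by omega))
        (b ∘ windowPair i n (by omega))) a) (mergeB h i b) Q
      exact ⟨fun x y => by rw [add_mul, h₂.map_add],
        fun r x => by rw [smul_mul_assoc, h₂.map_smul]⟩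

/-- `f ∘_i g`, for `f ∈ C^m`, `g ∈ C^n` and `0 ≤ i ≤ m - 1`, a cochain of degree `m + n - 1`. -/
noncomputable def Coch.circAt (h : N + 1 = m + n) (i : Fin m) (f : Coch k A B m)
    (g : Coch k A B n) : Coch k A B N :=
  Coch.mk (fun a b => f.eval
    (mergeA h i (g.eval (a ∘ window i n (by omega)) (b ∘ windowPair i n (by omega))) a)
    (mergeB h i b)) (SepLin.merge h i f g)

/-- `f ∘ g = ∑_{i=0}^{m-1} (-1)^{(n-1) i} f ∘_i g`. -/
noncomputable def Coch.circ (h : N + 1 = m + n) (f : Coch k A B m) (g : Coch k A B n) :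
    Coch k A B N :=
  ∑ i : Fin m, (((n : ℤ) - 1) * (i : ℤ)).negOnePow • Coch.circAt h i f g

/-- The product of the entries `b_{u,v}` with `u < m ≤ v`. -/
def crossProd (m : ℕ) (b : Pair N → B) : B :=
  ∏ P : Pair N with (P.1.1 : ℕ) < m ∧ m ≤ (P.1.2 : ℕ), b P

theorem crossProd_update_of_mem (m : ℕ) (b : Pair N → B) (P : Pair N)
    (hP : (P.1.1 : ℕ) < m ∧ m ≤ (P.1.2 : ℕ)) :
    ∃ c : B, ∀ y, crossProd m (Function.update b P y) = y * c := by
  refine ⟨∏ R ∈ (Finset.univ.filter fun R : Pair N =>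
    (R.1.1 : ℕ) < m ∧ m ≤ (R.1.2 : ℕ)).erase P, b R, fun y => ?_⟩
  rw [crossProd, ← Finset.mul_prod_erase _ _ (a := P) (by simpa using hP), Function.update_self]
  congr 1
  refine Finset.prod_congr rfl fun R hR => ?_
  rw [Function.update_of_ne (Finset.ne_of_mem_erase hR)]

theorem crossProd_update_of_notMem (m : ℕ) (b : Pair N → B) (P : Pair N)
    (hP : ¬ ((P.1.1 : ℕ) < m ∧ m ≤ (P.1.2 : ℕ))) (y : B) :
    crossProd m (Function.update b P y) = crossProd m b := by
  refine Finset.prod_congr rfl fun R hR => ?_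
  rw [Function.update_of_ne]
  rintro rfl
  simp only [Finset.mem_filter, Finset.mem_univ, true_and] at hR
  exact hP hR

theorem SepLin.cross (ε : B →ₐ[k] A) (β : A → A → A → A)
    (h₁ : ∀ y z, IsLinearMap k fun x => β x y z) (h₂ : ∀ x z, IsLinearMap k fun y => β x y z)
    (h₃ : ∀ x y, IsLinearMap k fun z => β x y z)
    (h : m + n = N) (f : Coch k A B m) (g : Coch k A B n) :
    SepLin k fun (a : Fin N → A) (b : Pair N → B) =>
      β (f.eval (a ∘ window 0 m (by omega)) (b ∘ windowPair 0 m (by omega)))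
        (ε (crossProd m b))
        (g.eval (a ∘ window m n (by omega)) (b ∘ windowPair m n (by omega))) where
  left a b j := by
    have hw : 0 + m ≤ N := by omega
    have hw' : m + n ≤ N := by omega
    by_cases hj : (j : ℕ) < m
    · obtain ⟨t, rfl⟩ := mem_range_window (h := hw) |>.2
        (show 0 ≤ (j : ℕ) ∧ (j : ℕ) < 0 + m by omega)
      have e : ∀ x, Function.update a (window 0 m hw t) x ∘ window m n (by omega) =
          a ∘ window (N := N) m n (by omega) := fun x =>
        Function.update_comp_eq_of_notMem_range _ _ fun hr => by
          have := mem_range_window.1 hr; omega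
      simp only [e, Function.update_comp_eq_of_injective _ (window_injective _ _ _)]
      have l := f.eval_sepLin.left (a ∘ window 0 m (by omega)) (b ∘ windowPair 0 m (by omega)) t
      exact ⟨fun x y => by rw [l.map_add, (h₁ _ _).map_add],
        fun c x => by rw [l.map_smul, (h₁ _ _).map_smul]⟩
    · obtain ⟨t, rfl⟩ := mem_range_window (h := hw') |>.2
        (show m ≤ (j : ℕ) ∧ (j : ℕ) < m + n by omega)
      have e : ∀ x, Function.update a (window m n hw' t) x ∘ window 0 m (by omega) =
          a ∘ window (N := N) 0 m (by omega) := fun x =>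
        Function.update_comp_eq_of_notMem_range _ _ fun hr => by
          have := mem_range_window.1 hr; omega
      simp only [e, Function.update_comp_eq_of_injective _ (window_injective _ _ _)]
      have l := g.eval_sepLin.left (a ∘ window m n (by omega)) (b ∘ windowPair m n (by omega)) t
      exact ⟨fun x y => by rw [l.map_add, (h₃ _ _).map_add],
        fun c x => by rw [l.map_smul, (h₃ _ _).map_smul]⟩
  right a b P := by
    have hw : 0 + m ≤ N := by omega
    have hw' : m + n ≤ N := by omega
    have hlt : (P.1.1 : ℕ) < P.1.2 := P.2
    by_cases hP : (P.1.1 : ℕ) < m ∧ m ≤ (P.1.2 : ℕ)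
    · have e₁ : ∀ y, Function.update b P y ∘ windowPair 0 m (by omega) =
          b ∘ windowPair (N := N) 0 m (by omega) := fun x =>
        Function.update_comp_eq_of_notMem_range _ _ fun hr => by
          have := mem_range_windowPair.1 hr; omega
      have e₂ : ∀ y, Function.update b P y ∘ windowPair m n (by omega) =
          b ∘ windowPair (N := N) m n (by omega) := fun x =>
        Function.update_comp_eq_of_notMem_range _ _ fun hr => by
          have := mem_range_windowPair.1 hr; omega
      obtain ⟨c, hc⟩ := crossProd_update_of_mem m b P hP
      simp only [e₁, e₂, hc]
      exact ⟨fun x y => by rw [add_mul, map_add, (h₂ _ _).map_add],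
        fun r x => by rw [smul_mul_assoc, map_smul, (h₂ _ _).map_smul]⟩
    · simp only [crossProd_update_of_notMem m b P hP]
      by_cases hP' : (P.1.2 : ℕ) < m
      · obtain ⟨t, rfl⟩ := mem_range_windowPair (h := hw) |>.2
          (show 0 ≤ (P.1.1 : ℕ) ∧ (P.1.2 : ℕ) < 0 + m by omega)
        have e : ∀ x, Function.update b (windowPair 0 m hw t) x ∘
            windowPair m n (by omega) = b ∘ windowPair (N := N) m n (by omega) := fun x =>
          Function.update_comp_eq_of_notMem_range _ _ fun hr => by
            have := mem_range_windowPair.1 hr; omega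
        simp only [e, Function.update_comp_eq_of_injective _ (windowPair_injective _ _ _)]
        have l := f.eval_sepLin.right (a ∘ window 0 m (by omega))
          (b ∘ windowPair 0 m (by omega)) t
        exact ⟨fun x y => by rw [l.map_add, (h₁ _ _).map_add],
          fun c x => by rw [l.map_smul, (h₁ _ _).map_smul]⟩
      · have := P.1.2.2
        obtain ⟨t, rfl⟩ := mem_range_windowPair (h := hw') |>.2
          (show m ≤ (P.1.1 : ℕ) ∧ (P.1.2 : ℕ) < m + n by omega)
        have e : ∀ x, Function.update b (windowPair m n hw' t) x ∘
            windowPair 0 m (by omega) = b ∘ windowPair (N := N) 0 m (by omega) := fun x =>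
          Function.update_comp_eq_of_notMem_range _ _ fun hr => by
            have := mem_range_windowPair.1 hr; omega
        simp only [e, Function.update_comp_eq_of_injective _ (windowPair_injective _ _ _)]
        have l := g.eval_sepLin.right (a ∘ window m n (by omega))
          (b ∘ windowPair m n (by omega)) t
        exact ⟨fun x y => by rw [l.map_add, (h₃ _ _).map_add],
          fun c x => by rw [l.map_smul, (h₃ _ _).map_smul]⟩

/-- The cup product of `f ∈ C^m` and `g ∈ C^n`:
`f(T^0_m) · ∏_{i ≤ m < j} ε(b_{i,j}) · g(T^m_{m+n})` (indices from `1`). -/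
noncomputable def Coch.cup (ε : B →ₐ[k] A) (h : m + n = N) (f : Coch k A B m)
    (g : Coch k A B n) : Coch k A B N :=
  Coch.mk (fun a b =>
    f.eval (a ∘ window 0 m (by omega)) (b ∘ windowPair 0 m (by omega)) * ε (crossProd m b) *
      g.eval (a ∘ window m n (by omega)) (b ∘ windowPair m n (by omega)))
    (SepLin.cross ε (fun x y z => x * y * z)
      (fun _ _ => ⟨fun _ _ => by simp only [add_mul], fun _ _ => by simp only [smul_mul_assoc]⟩)
      (fun _ _ => ⟨fun _ _ => by simp only [add_mul, mul_add], fun _ _ => by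
        simp only [smul_mul_assoc, mul_smul_comm]⟩)
      (fun _ _ => ⟨fun _ _ => by simp only [mul_add], fun _ _ => by
        simp only [mul_smul_comm]⟩) h f g)

/-- The identity of `A` as a cochain of degree one. -/
noncomputable def Coch.one : Coch k A B 1 :=
  Coch.mk (fun a _ => a 0)
    ⟨fun a b j => by
      rw [Subsingleton.elim j 0]
      exact ⟨fun x y => by simp, fun c x => by simp⟩,
    fun a b P => absurd P.2 (by rw [Subsingleton.elim P.1.1 P.1.2]; exact lt_irrefl _)⟩

/-- The cochain `a₁ ⊗ a₂ ⊗ b ↦ ε(b) a₁ a₂` of degree two. -/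
noncomputable def Coch.mulCoch (ε : B →ₐ[k] A) : Coch k A B 2 :=
  Coch.mk (fun a b => ε (b ⟨(0, 1), by decide⟩) * a 0 * a 1)
    ⟨fun a b j => by
      fin_cases j
      · exact ⟨fun x y => by simp [mul_add, add_mul], fun c x => by simp⟩
      · exact ⟨fun x y => by simp [mul_add], fun c x => by simp⟩,
    fun a b P => by
      have hP : P = ⟨(0, 1), by decide⟩ := by
        obtain ⟨⟨x, y⟩, h⟩ := P
        simp only [Fin.lt_def] at h
        refine Subtype.ext (Prod.ext (Fin.ext ?_) (Fin.ext ?_)) <;> simp <;> omega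
      subst hP
      exact ⟨fun x y => by simp [add_mul], fun c x => by simp⟩⟩

/-- The first term of the differential: `T ↦ a_1 ε(b_{1,2} ⋯ b_{1,n+1}) f(T^1_{n+1})`
(indices from `1`). -/
noncomputable def Coch.deltaFirst (ε : B →ₐ[k] A) (f : Coch k A B n) : Coch k A B (n + 1) :=
  Coch.mk (fun a b => a 0 * ε (crossProd 1 b) *
      f.eval (a ∘ window 1 n (by omega)) (b ∘ windowPair 1 n (by omega))) <| by
    have := SepLin.cross ε (fun x y z => x * y * z)
      (fun _ _ => ⟨fun _ _ => by simp only [add_mul], fun _ _ => by simp only [smul_mul_assoc]⟩)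
      (fun _ _ => ⟨fun _ _ => by simp only [add_mul, mul_add], fun _ _ => by
        simp only [smul_mul_assoc, mul_smul_comm]⟩)
      (fun _ _ => ⟨fun _ _ => by simp only [mul_add], fun _ _ => by
        simp only [mul_smul_comm]⟩) (show 1 + n = n + 1 by omega) (Coch.one (k := k)) f
    have e : window (N := n + 1) 0 1 (by omega) 0 = 0 := rfl
    simpa only [Coch.one, Coch.eval_mk, Function.comp_apply, e] using this

/-- The middle terms of the differential: `T ↦ f(M_{i,i+1})`, where the matrix `M_{i,i+1}` is
obtained from `T` by merging the indices `i` and `i + 1`, with diagonal entry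
`ε(b_{i,i+1}) a_i a_{i+1}`. -/
noncomputable def Coch.deltaMiddle (ε : B →ₐ[k] A) (f : Coch k A B n) (i : Fin n) :
    Coch k A B (n + 1) :=
  Coch.mk (fun a b => f.eval
      (mergeA (n := 2) rfl i
        (ε (b ⟨(i.castSucc, i.succ), Fin.castSucc_lt_succ⟩) * a i.castSucc * a i.succ) a)
      (mergeB (n := 2) rfl i b)) <| by
    have := SepLin.merge (show n + 1 + 1 = n + 2 from rfl) i f (Coch.mulCoch ε)
    have e₀ : window (N := n + 1) i 2 (by omega) 0 = i.castSucc := rfl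
    have e₁ : window (N := n + 1) i 2 (by omega) 1 = i.succ := rfl
    simpa only [Coch.mulCoch, Coch.eval_mk, Function.comp_apply, windowPair, e₀, e₁] using this

/-- The last term of the differential, without its sign:
`T ↦ f(T^0_n) a_{n+1} ε(b_{1,n+1} ⋯ b_{n,n+1})` (indices from `1`). -/
noncomputable def Coch.deltaLast (ε : B →ₐ[k] A) (f : Coch k A B n) : Coch k A B (n + 1) :=
  Coch.mk (fun a b => f.eval (a ∘ window 0 n (by omega)) (b ∘ windowPair 0 n (by omega)) *
      a (Fin.last n) * ε (crossProd n b)) <| by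
    have := SepLin.cross ε (fun x y z => x * z * y)
      (fun _ _ => ⟨fun _ _ => by simp only [add_mul], fun _ _ => by simp only [smul_mul_assoc]⟩)
      (fun _ _ => ⟨fun _ _ => by simp only [mul_add], fun _ _ => by
        simp only [mul_smul_comm]⟩)
      (fun _ _ => ⟨fun _ _ => by simp only [add_mul, mul_add], fun _ _ => by
        simp only [smul_mul_assoc, mul_smul_comm]⟩) (show n + 1 = n + 1 from rfl) f
      (Coch.one (k := k))
    have e : window (N := n + 1) n 1 (by omega) 0 = Fin.last n := rfl
    simpa only [Coch.one, Coch.eval_mk, Function.comp_apply, e] using this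

/-- The differential `δ^ε : C^n → C^{n+1}`. -/
noncomputable def Coch.delta (ε : B →ₐ[k] A) (f : Coch k A B n) : Coch k A B (n + 1) :=
  f.deltaFirst ε + ∑ i : Fin n, ((i : ℤ) + 1).negOnePow • f.deltaMiddle ε i +
    ((n : ℤ) + 1).negOnePow • f.deltaLast ε

end Cochains

section Graded

variable (k A B : Type*) [Field k] [Ring A] [Algebra k A] [CommRing B] [Algebra k B]

/-- The cochain groups in all integer degrees, with `C^n = 0` for `n < 0`. -/
def Cochain : ℤ → Type _
  | Int.ofNat n => Coch k A B n
  | Int.negSucc _ => PUnit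

noncomputable instance : ∀ n : ℤ, AddCommGroup (Cochain k A B n)
  | Int.ofNat n => inferInstanceAs (AddCommGroup (Coch k A B n))
  | Int.negSucc _ => inferInstanceAs (AddCommGroup PUnit)

variable {k A B}

-- In the three operations below, the degree of the result is given up to an equality of integers.

/-- `∘ : C^m × C^n → C^{m+n-1}`. -/
noncomputable def circ : {m n p : ℤ} → p + 1 = m + n → Cochain k A B m → Cochain k A B n →
    Cochain k A B p
  | Int.ofNat _, Int.ofNat _, Int.ofNat _, h, f, g =>
    Coch.circ (by simp only [Int.ofNat_eq_natCast] at h; omega) f g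
  | _, _, _, _, _, _ => 0

/-- `⌣ : C^m × C^n → C^{m+n}`. -/
noncomputable def cup (ε : B →ₐ[k] A) : {m n p : ℤ} → m + n = p → Cochain k A B m →
    Cochain k A B n → Cochain k A B p
  | Int.ofNat _, Int.ofNat _, Int.ofNat _, h, f, g =>
    Coch.cup ε (by simp only [Int.ofNat_eq_natCast] at h; omega) f g
  | _, _, _, _, _, _ => 0

/-- `δ^ε : C^n → C^{n+1}`. -/
noncomputable def delta (ε : B →ₐ[k] A) : {n p : ℤ} → n + 1 = p → Cochain k A B n →
    Cochain k A B p
  | Int.ofNat n, _, h, f => h ▸ (show Cochain k A B (Int.ofNat (n + 1)) from Coch.delta ε f)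
  | Int.negSucc _, _, _, _ => 0

end Graded

end SecondaryHochschild

/-! The spaces $C^n$ form a non-symmetric operad under the partial compositions $\circ_i$, and
$\delta^\varepsilon$ and $\smile$ both come from one element $\mu\in C^2$ (`Coch.mulCoch`),
$\mu(a_1,a_2,b)=\varepsilon(b)a_1a_2$. Since $\varepsilon(B)$ is central, $\delta^\varepsilon
f=(-1)^{n-1}\mu\circ f-f\circ\mu$ for $f\in C^n$ (`Coch.delta_eq_circ`) and $f\smile g=(\mu\circ_0
f)\circ_m g$ for $f\in C^m$ (`Coch.cup_eq_circAt`).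

The two operad axioms (`Coch.circAt_circAt_of_mem`, `Coch.circAt_circAt_of_lt`) show that the
associator $(f\circ g)\circ e-f\circ(g\circ e)$ consists of the terms in which $g$ and $e$ occupy
different slots of $f$ (`circ_circ`). Exchanging $g$ and $e$ swaps the two possible orders of these
slots, up to the sign $(-1)^{(n-1)(p-1)}$ (`lowSum_eq_smul_highSum`): this is the graded right
pre-Lie identity.

With $\delta^\varepsilon$ expanded, the left side is a signed sum of the associators of $(f,g,\mu)$,
$(f,\mu,g)$ and $(\mu,f,g)$. The first two cancel. In the third, $\mu$ has only two slots, so just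
$f\smile g$ and $g\smile f$ remain. -/

namespace SecondaryHochschild

/-! ### Products of entries along the fibres of a map of indices -/

section Push

variable {B : Type*} [CommMonoid B] {K M N : ℕ}

/-- The upper triangular matrix obtained by multiplying the entries of `b` along the fibres of
`φ`; entries whose row and column have the same image are dropped. -/
def pushB (φ : Fin N → Fin M) (b : Pair N → B) (Q : Pair M) : B :=
  ∏ P : Pair N with φ P.1.1 = Q.1.1 ∧ φ P.1.2 = Q.1.2, b P

/-- Monotonicity ensures that an entry whose row and column are separated by `ψ ∘ φ` already lands
strictly above the diagonal under `φ`, so the intermediate matrix does not lose it. -/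
theorem pushB_pushB (φ : Fin N → Fin M) (ψ : Fin M → Fin K) (hφ : Monotone φ)
    (b : Pair N → B) : pushB ψ (pushB φ b) = pushB (ψ ∘ φ) b := by
  funext Q
  simp only [pushB, Finset.prod_filter]
  simp_rw [← Finset.prod_filter (fun P : Pair M => ψ P.1.1 = Q.1.1 ∧ ψ P.1.2 = Q.1.2)]
  rw [Finset.prod_comm]
  refine Finset.prod_congr rfl fun R _ => ?_
  simp only [Function.comp_apply]
  by_cases hR : ψ (φ R.1.1) = Q.1.1 ∧ ψ (φ R.1.2) = Q.1.2
  · have hlt : φ R.1.1 < φ R.1.2 := by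
      refine lt_of_le_of_ne (hφ R.2.le) fun he => ?_
      have := Q.2
      rw [← hR.1, ← hR.2, he] at this
      exact lt_irrefl _ this
    rw [if_pos hR, Finset.prod_eq_single (⟨(φ R.1.1, φ R.1.2), hlt⟩ : Pair M)]
    · simp
    · intro P _ hP
      exact if_neg fun h => hP (Subtype.ext (Prod.ext h.1.symm h.2.symm))
    · intro h
      exact absurd (by simpa using hR) h
  · rw [if_neg hR]
    refine Finset.prod_eq_one fun P hP => if_neg fun h => hR ?_
    rw [h.1, h.2]
    exact (Finset.mem_filter.1 hP).2

theorem pushB_id (b : Pair N → B) : pushB id b = b := by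
  funext Q
  rw [pushB, Finset.prod_eq_single Q]
  · rintro P hP hne
    simp only [id, Finset.mem_filter] at hP
    exact absurd (Subtype.ext (Prod.ext hP.2.1 hP.2.2)) hne
  · simp

/-- `H` says that the preimage of the target window under `φ` is exactly the source window and that
`φ` restricts to `φ'` there. Hence the fibres over the target window can be computed inside the
source window. -/
theorem pushB_comp_windowPair {i i' n n' : ℕ} (hw : i + n ≤ N) (hw' : i' + n' ≤ M)
    (φ : Fin N → Fin M) (φ' : Fin n → Fin n') (b : Pair N → B)
    (H : ∀ t s, φ t = window i' n' hw' s ↔ ∃ u, window i n hw u = t ∧ φ' u = s) :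
    pushB φ b ∘ windowPair i' n' hw' = pushB φ' (b ∘ windowPair i n hw) := by
  funext Q
  symm
  refine Finset.prod_bij (fun R _ => windowPair i n hw R) ?_
    (fun R _ R' _ h => windowPair_injective i n hw h) ?_ (fun _ _ => rfl)
  · intro R hR
    simp only [Finset.mem_filter, Finset.mem_univ, true_and] at hR ⊢
    exact ⟨(H _ _).2 ⟨_, rfl, hR.1⟩, (H _ _).2 ⟨_, rfl, hR.2⟩⟩
  · intro P hP
    simp only [Finset.mem_filter, Finset.mem_univ, true_and] at hP
    obtain ⟨u, hu, hu'⟩ := (H _ _).1 hP.1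
    obtain ⟨v, hv, hv'⟩ := (H _ _).1 hP.2
    have hlt : u < v := by
      have : (P.1.1 : ℕ) < P.1.2 := P.2
      rw [← hu, ← hv] at this
      simp only [window] at this
      exact Fin.lt_def.2 (by omega)
    refine ⟨⟨(u, v), hlt⟩, ?_, Subtype.ext (Prod.ext hu hv)⟩
    simpa using ⟨hu', hv'⟩

theorem mergeB_eq_pushB {m n : ℕ} (h : N + 1 = m + n) (i : Fin m) (b : Pair N → B) :
    mergeB h i b = pushB (collapse h i) b := rfl

theorem collapse_monotone {m n : ℕ} (h : N + 1 = m + n) (i : Fin m) :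
    Monotone (collapse (N := N) h i) := by
  intro s t hst
  simp only [Fin.le_def, collapse] at hst ⊢
  split_ifs <;> omega

end Push

/-! ### Iterated merging of nested and of disjoint windows -/

section Merge

theorem window_val {N : ℕ} (i n : ℕ) (h : i + n ≤ N) (j : Fin n) :
    (window i n h j : ℕ) = i + j := rfl

theorem collapse_val {m n N : ℕ} (h : N + 1 = m + n) (i : Fin m) (t : Fin N) :
    (collapse h i t : ℕ) =
      if (t : ℕ) < i then (t : ℕ) else if (t : ℕ) < i + n then (i : ℕ) else t + 1 - n := rfl

variable {A B : Type*} [CommMonoid B] {m n p K M N M' : ℕ}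

/-! Merging inside a window that is merged afterwards. -/

theorem mergeA_mergeA_of_mem (h₁ : M + 1 = m + n) (h₂ : N + 1 = M + p) (h₄ : N + 1 = m + K)
    (i : Fin m) (j : Fin M) (l : Fin n) (hj : (j : ℕ) = i + l) (x y : A) (a : Fin N → A) :
    mergeA h₁ i x (mergeA h₂ j y a) = mergeA h₄ i x a := by
  funext s
  have := l.2
  have := s.2
  simp only [mergeA, Fin.lt_def, Fin.ext_iff]
  split_ifs <;> first | rfl | omega |
    exact congrArg a (Fin.ext (by first | omega | (simp only; omega)))

theorem mergeA_comp_window_of_mem (h₁ : M + 1 = m + n) (h₂ : N + 1 = M + p) (h₃ : K + 1 = n + p)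
    (i : Fin m) (j : Fin M) (l : Fin n) (hj : (j : ℕ) = i + l) (y : A) (a : Fin N → A) :
    mergeA h₂ j y a ∘ window i n (by omega) = mergeA h₃ l y (a ∘ window i K (by omega)) := by
  funext s
  have := s.2
  have := window_val i n (N := M) (by omega) s
  simp only [mergeA, Fin.lt_def, Fin.ext_iff, Function.comp_apply]
  split_ifs <;> first | rfl | omega |
    exact congrArg a (Fin.ext (by first | omega | (simp only [window]; omega)))

theorem collapse_collapse_of_mem (h₁ : M + 1 = m + n) (h₂ : N + 1 = M + p)
    (h₄ : N + 1 = m + K) (i : Fin m) (j : Fin M) (l : Fin n) (hj : (j : ℕ) = i + l) :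
    collapse h₁ i ∘ collapse h₂ j = collapse h₄ i := by
  funext t
  have := l.2
  have := t.2
  simp only [collapse, Fin.ext_iff, Function.comp_apply]
  split_ifs <;> omega

theorem mergeB_mergeB_of_mem (h₁ : M + 1 = m + n) (h₂ : N + 1 = M + p)
    (h₄ : N + 1 = m + K) (i : Fin m) (j : Fin M) (l : Fin n) (hj : (j : ℕ) = i + l)
    (b : Pair N → B) : mergeB h₁ i (mergeB h₂ j b) = mergeB h₄ i b := by
  simp only [mergeB_eq_pushB]
  rw [pushB_pushB _ _ (collapse_monotone h₂ j), collapse_collapse_of_mem h₁ h₂ h₄ i j l hj]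

theorem mergeB_comp_windowPair_of_mem (h₁ : M + 1 = m + n) (h₂ : N + 1 = M + p)
    (h₃ : K + 1 = n + p) (i : Fin m) (j : Fin M) (l : Fin n) (hj : (j : ℕ) = i + l) (b : Pair N → B) :
    mergeB h₂ j b ∘ windowPair i n (by omega) =
      mergeB h₃ l (b ∘ windowPair i K (by omega)) := by
  simp only [mergeB_eq_pushB]
  refine pushB_comp_windowPair _ _ _ _ _ fun t s => ?_
  have := l.2
  have := t.2
  have := s.2
  constructor
  · intro H
    simp only [collapse, window, Fin.ext_iff] at H
    have hK : (i : ℕ) ≤ t ∧ (t : ℕ) < i + K := by split_ifs at H <;> omega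
    refine ⟨⟨t - i, by omega⟩, ?_, ?_⟩
    · simp only [window, Fin.ext_iff]; omega
    · simp only [collapse, Fin.ext_iff]
      split_ifs at H ⊢ <;> omega
  · rintro ⟨u, rfl, rfl⟩
    have := u.2
    have e₁ := collapse_val h₂ j (window i K (by omega) u)
    have e₂ := collapse_val h₃ l u
    rw [window_val] at e₁
    rw [Fin.ext_iff, window_val]
    split_ifs at e₁ e₂ <;> omega

/-! Merging two disjoint windows. -/

/-- Replacing slot `i` by `n` indices moves the later slot `i'` to `i' + n - 1`, while expanding
`i'` leaves `i` in place; hence the values of `j` and `l`. The case `n = 0` is included, with a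
shift by `-1`. -/
theorem mergeA_mergeA_of_lt (h₁ : M + 1 = m + n) (h₂ : N + 1 = M + p) (h₃ : M' + 1 = m + p)
    (h₄ : N + 1 = M' + n) (i i' : Fin m) (j : Fin M) (l : Fin M') (hi : i < i')
    (hj : (j : ℕ) + 1 = i' + n) (hl : (l : ℕ) = i) (x y : A) (a : Fin N → A) :
    mergeA h₁ i x (mergeA h₂ j y a) = mergeA h₃ i' y (mergeA h₄ l x a) := by
  funext s
  have := s.2
  have := i'.2
  simp only [mergeA, Fin.lt_def, Fin.ext_iff] at hi ⊢
  split_ifs <;> first | rfl | omega |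
    exact congrArg a (Fin.ext (by first | omega | (simp only; omega)))

theorem mergeB_mergeB_of_lt (h₁ : M + 1 = m + n) (h₂ : N + 1 = M + p) (h₃ : M' + 1 = m + p)
    (h₄ : N + 1 = M' + n) (i i' : Fin m) (j : Fin M) (l : Fin M') (hi : i < i')
    (hj : (j : ℕ) + 1 = i' + n) (hl : (l : ℕ) = i) (b : Pair N → B) :
    mergeB h₁ i (mergeB h₂ j b) = mergeB h₃ i' (mergeB h₄ l b) := by
  simp only [mergeB_eq_pushB]
  rw [pushB_pushB _ _ (collapse_monotone h₂ j), pushB_pushB _ _ (collapse_monotone h₄ l)]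
  congr 1
  funext t
  have := i'.2
  have := t.2
  simp only [collapse, Fin.ext_iff, Fin.lt_def, Function.comp_apply] at hi ⊢
  split_ifs <;> omega

theorem mergeA_comp_window_of_le (h : N + 1 = M + p) (j : Fin M) (i : ℕ) (hi : i + n ≤ j) (y : A)
    (a : Fin N → A) :
    mergeA h j y a ∘ window i n (by omega) = a ∘ window i n (by omega) := by
  funext s
  have := s.2
  have := window_val i n (N := M) (by omega) s
  simp only [mergeA, Fin.lt_def, Fin.ext_iff, Function.comp_apply]
  split_ifs <;> first | rfl | omega

theorem mergeB_comp_windowPair_of_le (h : N + 1 = M + p) (j : Fin M) (i : ℕ) (hi : i + n ≤ j)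
    (b : Pair N → B) :
    mergeB h j b ∘ windowPair i n (by omega) = b ∘ windowPair i n (by omega) := by
  rw [mergeB_eq_pushB, pushB_comp_windowPair (i := i) (by omega) (by omega) _ id b, pushB_id]
  intro t s
  have := s.2
  have := t.2
  simp only [id, exists_eq_right]
  simp only [Fin.ext_iff, collapse_val, window_val]
  split_ifs <;> omega

theorem mergeA_comp_window_of_lt (h : N + 1 = M + p) (j : Fin M) (i : ℕ) (hi : j < i)
    (hw : i + n ≤ M) (y : A) (a : Fin N → A) :
    mergeA h j y a ∘ window i n hw = a ∘ window (i + p - 1) n (by omega) := by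
  funext s
  have := s.2
  have := window_val i n (N := M) (by omega) s
  simp only [mergeA, Fin.lt_def, Fin.ext_iff, Function.comp_apply]
  split_ifs <;> first | rfl | omega |
    exact congrArg a (Fin.ext (by first | omega | (simp only [window]; omega)))

theorem mergeB_comp_windowPair_of_lt (h : N + 1 = M + p) (j : Fin M) (i : ℕ) (hi : j < i)
    (hw : i + n ≤ M) (b : Pair N → B) :
    mergeB h j b ∘ windowPair i n hw = b ∘ windowPair (i + p - 1) n (by omega) := by
  -- Right of the merged index, `collapse` is a translation, so the induced map of windows is `id`.
  -- The subtraction is not truncated, as `j < i` forces `1 ≤ i`.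
  rw [mergeB_eq_pushB, pushB_comp_windowPair (i := i + p - 1) (by omega) (by omega) _ id b,
    pushB_id]
  intro t s
  have := s.2
  have := t.2
  simp only [id, exists_eq_right]
  simp only [Fin.ext_iff, collapse_val, window_val]
  split_ifs <;> omega

end Merge

/-! ### The operad axioms for the partial compositions -/

section Operad

variable {k A B : Type*} [Field k] [Ring A] [Algebra k A] [CommRing B] [Algebra k B]
variable {m n p K M N M' : ℕ}

theorem Coch.ext_eval {f g : Coch k A B n} (h : ∀ a b, f.eval a b = g.eval a b) : f = g := by
  refine TensorProduct.ext (PiTensorProduct.ext (MultilinearMap.ext fun a => ?_))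
  refine PiTensorProduct.ext (MultilinearMap.ext fun b => ?_)
  exact h a b

theorem Coch.eval_circAt (h : N + 1 = m + n) (i : Fin m) (f : Coch k A B m) (g : Coch k A B n)
    (a : Fin N → A) (b : Pair N → B) :
    (Coch.circAt h i f g).eval a b = f.eval
      (mergeA h i (g.eval (a ∘ window i n (by omega)) (b ∘ windowPair i n (by omega))) a)
      (mergeB h i b) :=
  Coch.eval_mk _ _ a b

/-- Sequential axiom: `e` is inserted into a slot that belongs to `g`, so merging the window of `e`
and then that of `g` amounts to merging the large window at once. -/
theorem Coch.circAt_circAt_of_mem (h₁ : M + 1 = m + n) (h₂ : N + 1 = M + p) (h₃ : K + 1 = n + p)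
    (h₄ : N + 1 = m + K) (i : Fin m) (j : Fin M) (l : Fin n) (hj : (j : ℕ) = i + l)
    (f : Coch k A B m) (g : Coch k A B n) (e : Coch k A B p) :
    Coch.circAt h₂ j (Coch.circAt h₁ i f g) e = Coch.circAt h₄ i f (Coch.circAt h₃ l g e) := by
  refine Coch.ext_eval fun a b => ?_
  simp only [Coch.eval_circAt]
  rw [mergeA_mergeA_of_mem h₁ h₂ h₄ i j l hj, mergeB_mergeB_of_mem h₁ h₂ h₄ i j l hj,
    mergeA_comp_window_of_mem h₁ h₂ h₃ i j l hj,
    mergeB_comp_windowPair_of_mem h₁ h₂ h₃ i j l hj]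
  obtain ⟨j, _⟩ := j
  obtain rfl : j = i + l := hj
  congr 4
  congr 1 <;> funext s <;>
    simp only [Function.comp_apply, window, windowPair, Nat.add_assoc]

/-- Parallel axiom: `g` and `e` fill different slots of `f`, so their windows are disjoint and the
two merges commute. -/
theorem Coch.circAt_circAt_of_lt (h₁ : M + 1 = m + n) (h₂ : N + 1 = M + p) (h₃ : M' + 1 = m + p)
    (h₄ : N + 1 = M' + n) (i i' : Fin m) (j : Fin M) (l : Fin M') (hi : i < i')
    (hj : (j : ℕ) + 1 = i' + n) (hl : (l : ℕ) = i)
    (f : Coch k A B m) (g : Coch k A B n) (e : Coch k A B p) :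
    Coch.circAt h₂ j (Coch.circAt h₁ i f g) e = Coch.circAt h₄ l (Coch.circAt h₃ i' f e) g := by
  refine Coch.ext_eval fun a b => ?_
  have hi' : (i : ℕ) < i' := hi
  simp only [Coch.eval_circAt]
  rw [mergeA_mergeA_of_lt h₁ h₂ h₃ h₄ i i' j l hi hj hl,
    mergeB_mergeB_of_lt h₁ h₂ h₃ h₄ i i' j l hi hj hl,
    mergeA_comp_window_of_le h₂ j i (by omega), mergeB_comp_windowPair_of_le h₂ j i (by omega),
    mergeA_comp_window_of_lt h₄ l i' (by omega), mergeB_comp_windowPair_of_lt h₄ l i' (by omega)]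
  obtain ⟨j, _⟩ := j
  obtain ⟨l, _⟩ := l
  obtain rfl : l = i := hl
  obtain rfl : j = i' + n - 1 := by simp only at hj; omega
  rfl

end Operad

/-! ### The graded pre-Lie identity -/

section PreLie

variable {k A B : Type*} [Field k] [Ring A] [Algebra k A] [CommRing B] [Algebra k B]
variable {m n p K M N M' : ℕ}

theorem Coch.eval_add (f f' : Coch k A B n) (a : Fin n → A) (b : Pair n → B) :
    (f + f').eval a b = f.eval a b + f'.eval a b := rfl

theorem Coch.circAt_add_left (h : N + 1 = m + n) (i : Fin m) (f f' : Coch k A B m)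
    (g : Coch k A B n) :
    Coch.circAt h i (f + f') g = Coch.circAt h i f g + Coch.circAt h i f' g :=
  Coch.ext_eval fun a b => by simp only [Coch.eval_add, Coch.eval_circAt]

theorem Coch.circAt_add_right (h : N + 1 = m + n) (i : Fin m) (f : Coch k A B m)
    (g g' : Coch k A B n) :
    Coch.circAt h i f (g + g') = Coch.circAt h i f g + Coch.circAt h i f g' :=
  Coch.ext_eval fun a b => by
    simp only [Coch.eval_add, Coch.eval_circAt]
    -- The value of `g` enters the merged matrix only in diagonal slot `i`, so linearity of `f` in
    -- that slot suffices.
    have l := f.eval_sepLin.left (mergeA h i 0 a) (mergeB h i b) i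
    simp only [← mergeA_eq_update] at l
    exact l.map_add _ _

/-- The partial composition as a biadditive map. -/
noncomputable def circAtHom (h : N + 1 = m + n) (i : Fin m) :
    Coch k A B m →+ Coch k A B n →+ Coch k A B N :=
  AddMonoidHom.mk' (fun f => AddMonoidHom.mk' (Coch.circAt h i f) (Coch.circAt_add_right h i f))
    fun f f' => AddMonoidHom.ext fun g => Coch.circAt_add_left h i f f' g

/-- The composition as a biadditive map. -/
noncomputable def circHom (h : N + 1 = m + n) :
    Coch k A B m →+ Coch k A B n →+ Coch k A B N :=
  ∑ i : Fin m, ((((n : ℤ) - 1) * (i : ℤ)).negOnePow : ℤ) • circAtHom h i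

theorem circAtHom_apply (h : N + 1 = m + n) (i : Fin m) (f : Coch k A B m) (g : Coch k A B n) :
    circAtHom h i f g = Coch.circAt h i f g := rfl

theorem circHom_apply (h : N + 1 = m + n) (f : Coch k A B m) (g : Coch k A B n) :
    circHom h f g = Coch.circ h f g := by
  simp only [circHom, Coch.circ, AddMonoidHom.finsetSum_apply, AddMonoidHom.smul_apply,
    circAtHom_apply, Units.smul_def]

/-- A sum over the positions in `f ∘_i g`, split into those left of `g`, those in `g` and those
right of `g`. -/
theorem sum_fin_eq_sum_of_window {X : Type*} [AddCommMonoid X] (h : M + 1 = m + n) (i : Fin m)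
    (G : Fin M → X) :
    ∑ j, G j = (∑ j : Fin m, if hj : j < i then G ⟨j, by simp only [Fin.lt_def] at hj; omega⟩
        else 0)
      + ∑ l : Fin n, G ⟨i + l, by omega⟩
      + ∑ j : Fin m, if hj : i < j then G ⟨j + n - 1, by simp only [Fin.lt_def] at hj; omega⟩
          else 0 := by
  obtain ⟨i, hi⟩ := i
  -- `r` counts the slots of `f` right of `i`, so that `m = i + r + 1`.
  obtain ⟨r, rfl⟩ := Nat.exists_eq_add_of_lt hi
  obtain rfl : M = i + n + r := by omega
  let F : ℕ → X := fun j => if hj : j < i + n + r then G ⟨j, hj⟩ else 0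
  have e₁ : ∑ j, G j = ∑ j ∈ Finset.range (i + n + r), F j := by
    rw [← Fin.sum_univ_eq_sum_range]
    exact Finset.sum_congr rfl fun j _ => by simp [F]
  have e₂ : (∑ l : Fin n, G ⟨i + l, by omega⟩) = ∑ l ∈ Finset.range n, F (i + l) := by
    rw [← Fin.sum_univ_eq_sum_range fun l => F (i + l)]
    exact Finset.sum_congr rfl fun l _ => by
      have : i + (l : ℕ) < i + n + r := by omega
      simp [F, this]
  have e₃ : (∑ j : Fin (i + r + 1), if hj : j < ⟨i, hi⟩ then
      G ⟨j, by simp only [Fin.lt_def] at hj; omega⟩ else 0) = ∑ j ∈ Finset.range i, F j := by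
    have : ∀ j : Fin (i + r + 1), (if hj : j < ⟨i, hi⟩ then
      G ⟨j, by simp only [Fin.lt_def] at hj; omega⟩ else 0) = if (j : ℕ) < i then F j else 0 := by
      intro j
      simp only [Fin.lt_def, F]
      split_ifs <;> first | rfl | omega
    rw [Finset.sum_congr rfl fun j _ => this j,
      Fin.sum_univ_eq_sum_range (fun j => if j < i then F j else 0), ← Finset.sum_filter]
    congr 1
    ext j
    simp only [Finset.mem_filter, Finset.mem_range]
    omega
  have e₄ : (∑ j : Fin (i + r + 1), if hj : ⟨i, hi⟩ < j then
      G ⟨j + n - 1, by simp only [Fin.lt_def] at hj; omega⟩ else 0) =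
      ∑ j ∈ Finset.range r, F (i + n + j) := by
    have : ∀ j : Fin (i + r + 1), (if hj : ⟨i, hi⟩ < j then
      G ⟨j + n - 1, by simp only [Fin.lt_def] at hj; omega⟩ else 0) =
        if i < (j : ℕ) then F (j + n - 1) else 0 := by
      intro j
      simp only [Fin.lt_def, F]
      split_ifs <;> first | rfl | omega
    rw [Finset.sum_congr rfl fun j _ => this j,
      Fin.sum_univ_eq_sum_range (fun j => if i < j then F (j + n - 1) else 0),
      show i + r + 1 = i + 1 + r by omega, Finset.sum_range_add,
      Finset.sum_eq_zero fun j hj => if_neg (by simp only [Finset.mem_range] at hj; omega),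
      zero_add]
    refine Finset.sum_congr rfl fun j _ => ?_
    rw [if_pos (by omega)]
    congr 1
    omega
  rw [e₁, e₂, e₃, e₄, Finset.sum_range_add, Finset.sum_range_add]

/-- The terms of `(f ∘ g) ∘ e` in which `e` is inserted left of `g`. -/
noncomputable def lowSum (h₁ : M + 1 = m + n) (h₂ : N + 1 = M + p) (f : Coch k A B m)
    (g : Coch k A B n) (e : Coch k A B p) : Coch k A B N :=
  ∑ i : Fin m, ∑ j : Fin m, if hj : j < i then
    (((n : ℤ) - 1) * (i : ℤ) + ((p : ℤ) - 1) * (j : ℤ)).negOnePow •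
      Coch.circAt h₂ ⟨j, by simp only [Fin.lt_def] at hj; omega⟩ (Coch.circAt h₁ i f g) e else 0

/-- The terms of `(f ∘ g) ∘ e` in which `e` is inserted right of `g`. -/
noncomputable def highSum (h₁ : M + 1 = m + n) (h₂ : N + 1 = M + p) (f : Coch k A B m)
    (g : Coch k A B n) (e : Coch k A B p) : Coch k A B N :=
  ∑ i : Fin m, ∑ j : Fin m, if hj : i < j then
    (((n : ℤ) - 1) * (i : ℤ) + ((p : ℤ) - 1) * ((j : ℤ) + n - 1)).negOnePow •
      Coch.circAt h₂ ⟨j + n - 1, by simp only [Fin.lt_def] at hj; omega⟩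
        (Coch.circAt h₁ i f g) e else 0

/-- The parallel axiom matches the terms one by one. If `e` is inserted before `g`, then `g` sits `p
- 1` places further right, which costs the sign $(-1)^{(n-1)(p-1)}$. -/
theorem lowSum_eq_smul_highSum (h₁ : M + 1 = m + n) (h₂ : N + 1 = M + p) (h₃ : M' + 1 = m + p)
    (h₄ : N + 1 = M' + n) (f : Coch k A B m) (g : Coch k A B n) (e : Coch k A B p) :
    lowSum h₁ h₂ f g e = (((n : ℤ) - 1) * ((p : ℤ) - 1)).negOnePow • highSum h₃ h₄ f e g := by
  rw [lowSum, highSum, Finset.sum_comm, Finset.smul_sum]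
  refine Finset.sum_congr rfl fun j _ => ?_
  rw [Finset.smul_sum]
  refine Finset.sum_congr rfl fun i _ => ?_
  split_ifs with hj
  · have hj' : (j : ℕ) < i := hj
    rw [Coch.circAt_circAt_of_lt h₃ h₄ h₁ h₂ j i ⟨i + p - 1, by omega⟩ ⟨j, by omega⟩ hj
      (by simp only; omega) rfl, smul_smul, ← Int.negOnePow_add]
    congr 1
    rw [Int.negOnePow_eq_iff]
    exact ⟨-(((n : ℤ) - 1) * ((p : ℤ) - 1)), by ring⟩
  · rw [smul_zero]

/-- A slot of `f ∘_i g` lies left of `g`, in `g`, or right of `g`. The slots in `g` give `f ∘ (g ∘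
e)` by the sequential axiom, and the others form the associator. -/
theorem circ_circ (h₁ : M + 1 = m + n) (h₂ : N + 1 = M + p) (h₃ : K + 1 = n + p)
    (h₄ : N + 1 = m + K) (f : Coch k A B m) (g : Coch k A B n) (e : Coch k A B p) :
    Coch.circ h₂ (Coch.circ h₁ f g) e =
      Coch.circ h₄ f (Coch.circ h₃ g e) + (lowSum h₁ h₂ f g e + highSum h₁ h₂ f g e) := by
  have hl : Coch.circ h₂ (Coch.circ h₁ f g) e = ∑ i : Fin m, ∑ j : Fin M,
      (((n : ℤ) - 1) * (i : ℤ) + ((p : ℤ) - 1) * (j : ℤ)).negOnePow •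
        Coch.circAt h₂ j (Coch.circAt h₁ i f g) e := by
    rw [← circHom_apply h₂, Coch.circ, map_sum, AddMonoidHom.finsetSum_apply]
    refine Finset.sum_congr rfl fun i _ => ?_
    rw [Units.smul_def, map_zsmul, AddMonoidHom.smul_apply, circHom_apply, Coch.circ,
      Finset.smul_sum]
    refine Finset.sum_congr rfl fun j _ => ?_
    rw [← Units.smul_def, smul_smul, Int.negOnePow_add]
  have hr : Coch.circ h₄ f (Coch.circ h₃ g e) = ∑ i : Fin m, ∑ l : Fin n,
      (((n : ℤ) - 1) * (i : ℤ) + ((p : ℤ) - 1) * ((i : ℤ) + l)).negOnePow •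
        Coch.circAt h₄ i f (Coch.circAt h₃ l g e) := by
    rw [Coch.circ]
    refine Finset.sum_congr rfl fun i _ => ?_
    rw [← circAtHom_apply, Coch.circ, map_sum, Finset.smul_sum]
    refine Finset.sum_congr rfl fun l _ => ?_
    rw [Units.smul_def (Int.negOnePow (_ * (l : ℤ))), map_zsmul, ← Units.smul_def, smul_smul,
      circAtHom_apply, ← Int.negOnePow_add]
    congr 2
    -- The degree `K - 1 = (n - 1) + (p - 1)` is additive, so the sign at slot `i` splits as the
    -- nested signs require.
    have : (K : ℤ) = n + p - 1 := by omega
    rw [this]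
    ring
  rw [hl, hr, lowSum, highSum, ← Finset.sum_add_distrib, ← Finset.sum_add_distrib]
  refine Finset.sum_congr rfl fun i _ => ?_
  rw [sum_fin_eq_sum_of_window h₁ i, add_right_comm, ← add_assoc, add_comm (∑ l : Fin n, _),
    add_right_comm]
  congr 1
  · congr 1
    refine Finset.sum_congr rfl fun l _ => ?_
    rw [Coch.circAt_circAt_of_mem h₁ h₂ h₃ h₄ i _ l rfl]
    push_cast
    rfl
  · refine Finset.sum_congr rfl fun j _ => ?_
    split_ifs with hj
    · congr 3
      have : (i : ℕ) < j := hj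
      push_cast [Nat.cast_sub (show 1 ≤ (j : ℕ) + n by omega)]
      ring
    · rfl

end PreLie

/-! ### Differential and cup product in terms of the multiplication cochain -/

section Mul

variable {k A B : Type*} [Field k] [Ring A] [Algebra k A] [CommRing B] [Algebra k B]
variable {m n p K M N M' : ℕ}

/-- A two-block collapse leaves one entry above the diagonal: the product of all entries joining the
blocks, which is the argument of `ε` in the cup product and in the outer terms of the differential.
-/
theorem pushB_eq_crossProd (φ : Fin N → Fin 2) (c : ℕ) (hφ : ∀ t, φ t = 0 ↔ (t : ℕ) < c)
    (b : Pair N → B) : pushB φ b ⟨(0, 1), by decide⟩ = crossProd c b := by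
  refine Finset.prod_congr (Finset.filter_congr fun P _ => ?_) fun _ _ => rfl
  have : ∀ x : Fin 2, x = 1 ↔ ¬ x = 0 := by decide
  rw [this, hφ, hφ, not_lt]

theorem Coch.deltaMiddle_eq_circAt (ε : B →ₐ[k] A) (f : Coch k A B n) (i : Fin n) :
    f.deltaMiddle ε i = Coch.circAt (show n + 1 + 1 = n + 2 from rfl) i f (Coch.mulCoch ε) :=
  Coch.ext_eval fun a b => by
    rw [Coch.eval_circAt, Coch.mulCoch, Coch.eval_mk, Coch.deltaMiddle, Coch.eval_mk]
    rfl

theorem Coch.deltaLast_eq_circAt (ε : B →ₐ[k] A) (hε : ∀ b, ε b ∈ Subalgebra.center k A)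
    (f : Coch k A B n) (h : n + 1 + 1 = 2 + n) :
    f.deltaLast ε = Coch.circAt h 0 (Coch.mulCoch ε) f :=
  Coch.ext_eval fun a b => by
    rw [Coch.eval_circAt, Coch.mulCoch, Coch.eval_mk, Coch.deltaLast, Coch.eval_mk,
      mergeB_eq_pushB, pushB_eq_crossProd _ n, mul_assoc (ε _),
      Subalgebra.mem_center_iff.1 (hε _)]
    · congr 2
      simp [mergeA, Fin.last]
    · intro t
      simp only [collapse, Fin.ext_iff, Fin.val_zero]
      split_ifs <;> omega

theorem Coch.deltaFirst_eq_circAt (ε : B →ₐ[k] A) (hε : ∀ b, ε b ∈ Subalgebra.center k A)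
    (f : Coch k A B n) (h : n + 1 + 1 = 2 + n) :
    f.deltaFirst ε = Coch.circAt h 1 (Coch.mulCoch ε) f :=
  Coch.ext_eval fun a b => by
    rw [Coch.eval_circAt, Coch.mulCoch, Coch.eval_mk, Coch.deltaFirst, Coch.eval_mk,
      mergeB_eq_pushB, pushB_eq_crossProd _ 1, Subalgebra.mem_center_iff.1 (hε _)]
    · congr 2
    · intro t
      simp only [collapse, Fin.ext_iff, Fin.val_zero, Fin.val_one]
      split_ifs <;> first | omega | simp_all

/-- Once `f` fills slot `0` of the multiplication cochain, its slot `1` has become slot `m`.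
Centrality moves `ε` from the front to between the two factors. -/
theorem Coch.cup_eq_circAt (ε : B →ₐ[k] A) (hε : ∀ b, ε b ∈ Subalgebra.center k A)
    (f : Coch k A B m) (g : Coch k A B n) (h : m + n = N) (h₁ : M + 1 = 2 + m)
    (h₂ : N + 1 = M + n) :
    Coch.cup ε h f g =
      Coch.circAt h₂ ⟨m, by omega⟩ (Coch.circAt h₁ 0 (Coch.mulCoch ε) f) g :=
  Coch.ext_eval fun a b => by
    rw [Coch.eval_circAt, Coch.eval_circAt, Coch.mulCoch, Coch.eval_mk, Coch.cup, Coch.eval_mk,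
      mergeB_eq_pushB h₁, mergeB_eq_pushB h₂, pushB_pushB _ _ (collapse_monotone _ _),
      pushB_eq_crossProd _ m, Subalgebra.mem_center_iff.1 (hε _)]
    · have e₁ := mergeA_comp_window_of_le (n := m) h₂ ⟨m, by omega⟩ 0 (by simp)
        (g.eval (a ∘ window m n (by omega)) (b ∘ windowPair m n (by omega))) a
      have e₂ := mergeB_comp_windowPair_of_le (n := m) h₂ ⟨m, by omega⟩ 0 (by simp) b
      rw [mergeB_eq_pushB] at e₂
      simp only [Fin.val_zero, e₁, e₂]
      congr 1
      simp [mergeA]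
    · intro t
      simp only [collapse, Fin.ext_iff, Fin.val_zero, Function.comp_apply]
      split_ifs <;> omega

end Mul

/-! ### The identity in nonnegative degrees -/

section Delta

variable {k A B : Type*} [Field k] [Ring A] [Algebra k A] [CommRing B] [Algebra k B]
variable {m n N M : ℕ}

theorem Coch.circ_zero_left (h : N + 1 = m + n) (g : Coch k A B n) :
    Coch.circ h (0 : Coch k A B m) g = 0 := by
  rw [← circHom_apply, map_zero, AddMonoidHom.zero_apply]

theorem Coch.circ_zero_right (h : N + 1 = m + n) (f : Coch k A B m) :
    Coch.circ h f (0 : Coch k A B n) = 0 := by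
  rw [← circHom_apply, map_zero]

/-- The differential is the bracket with the multiplication cochain. -/
theorem Coch.delta_eq_circ (ε : B →ₐ[k] A) (hε : ∀ b, ε b ∈ Subalgebra.center k A)
    (f : Coch k A B n) (h : n + 1 + 1 = n + 2) (h' : n + 1 + 1 = 2 + n) :
    f.delta ε = ((n : ℤ) - 1).negOnePow • Coch.circ h' (Coch.mulCoch ε) f -
      Coch.circ h f (Coch.mulCoch ε) := by
  rw [Coch.delta, Coch.deltaFirst_eq_circAt ε hε f h', Coch.deltaLast_eq_circAt ε hε f h',
    Coch.circ, Coch.circ, Fin.sum_univ_two, smul_add, smul_smul, smul_smul]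
  -- As `i` starts at `0`, the sign of a middle term is opposite to its sign in `f ∘ μ`.
  have e : ∀ i : Fin n, ((i : ℤ) + 1).negOnePow • f.deltaMiddle ε i =
      -(((((2 : ℕ) : ℤ) - 1) * (i : ℤ)).negOnePow • Coch.circAt h i f (Coch.mulCoch ε)) := by
    intro i
    rw [Coch.deltaMiddle_eq_circAt, Int.negOnePow_succ, Units.neg_smul,
      show (((2 : ℕ) : ℤ) - 1) * (i : ℤ) = i by push_cast; ring]
  rw [Finset.sum_congr rfl fun i _ => e i]
  simp only [Finset.sum_neg_distrib, Fin.val_zero, Fin.val_one, Nat.cast_zero,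
    Nat.cast_one, mul_zero, mul_one, Int.negOnePow_zero, ← Int.negOnePow_add]
  -- Slot `1` of `μ` gives the first term with sign $+1$, and slot `0` gives the last term with sign
  -- $(-1)^{n-1}=(-1)^{n+1}$.
  rw [(Int.negOnePow_eq_iff ((n : ℤ) - 1 + ((n : ℤ) - 1)) 0).2 ⟨(n : ℤ) - 1, by ring⟩,
    (Int.negOnePow_eq_iff ((n : ℤ) - 1) ((n : ℤ) + 1)).2 ⟨-1, by ring⟩, Int.negOnePow_zero,
    one_smul]
  abel

/-- The only pair of slots `i < j` of the multiplication cochain is `(0, 1)`. -/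
theorem highSum_mulCoch (ε : B →ₐ[k] A) (hε : ∀ b, ε b ∈ Subalgebra.center k A)
    (h₁ : M + 1 = 2 + m) (h₂ : N + 1 = M + n) (h : m + n = N) (f : Coch k A B m)
    (g : Coch k A B n) :
    highSum h₁ h₂ (Coch.mulCoch ε) f g = (((n : ℤ) - 1) * m).negOnePow • Coch.cup ε h f g := by
  rw [highSum, Coch.cup_eq_circAt ε hε f g h h₁ h₂]
  simp [Fin.sum_univ_two]

/-- Here `m + n ≥ 1`, so `f ∘ g` has nonnegative degree and all three associators with `μ` are
available. -/
theorem Coch.circ_delta_of_succ (ε : B →ₐ[k] A) (hε : ∀ b, ε b ∈ Subalgebra.center k A)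
    (f : Coch k A B m) (g : Coch k A B n) (h : N + 1 = m + n)
    (h₁ : N + 1 + 1 = m + (n + 1)) (h₂ : N + 1 + 1 = m + 1 + n) (h₃ : n + m = N + 1)
    (h₄ : m + n = N + 1) :
    Coch.circ h₁ f (g.delta ε) - (Coch.circ h f g).delta ε +
        ((n : ℤ) - 1).negOnePow • Coch.circ h₂ (f.delta ε) g =
      ((n : ℤ) - 1).negOnePow •
        (Coch.cup ε h₃ g f - ((m : ℤ) * n).negOnePow • Coch.cup ε h₄ f g) := by
  set μ : Coch k A B 2 := Coch.mulCoch ε with hμ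
  have a₁ := circ_circ h (show N + 1 + 1 = N + 2 by omega) (show n + 1 + 1 = n + 2 by omega) h₁
    f g μ
  have a₂ := circ_circ (show m + 1 + 1 = m + 2 by omega) h₂ (show n + 1 + 1 = 2 + n by omega) h₁
    f μ g
  have a₃ := circ_circ (show m + 1 + 1 = 2 + m by omega) h₂ h (show N + 1 + 1 = 2 + N by omega)
    μ f g
  have l₁ := lowSum_eq_smul_highSum h (show N + 1 + 1 = N + 2 by omega)
    (show m + 1 + 1 = m + 2 by omega) h₂ f g μ
  have l₂ := lowSum_eq_smul_highSum (show m + 1 + 1 = m + 2 by omega) h₂ h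
    (show N + 1 + 1 = N + 2 by omega) f μ g
  have l₃ := lowSum_eq_smul_highSum (show m + 1 + 1 = 2 + m by omega) h₂
    (show n + 1 + 1 = 2 + n by omega) (show N + 1 + 1 = n + 1 + m by omega) μ f g
  rw [highSum_mulCoch ε hε _ _ h₃] at l₃
  rw [l₃, highSum_mulCoch ε hε _ _ h₄] at a₃
  rw [l₁] at a₁
  rw [l₂] at a₂
  rw [Coch.delta_eq_circ ε hε f (by omega) (by omega),
    Coch.delta_eq_circ ε hε g (by omega) (by omega), Coch.delta_eq_circ ε hε _ (by omega) (by omega)]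
  simp only [← hμ]
  have d₁ : ∀ x y : Coch k A B (n + 1), Coch.circ h₁ f (((n : ℤ) - 1).negOnePow • x - y) =
      ((n : ℤ) - 1).negOnePow • Coch.circ h₁ f x - Coch.circ h₁ f y := by
    intro x y
    simp only [← circHom_apply, map_sub, Units.smul_def, map_zsmul]
  have d₂ : ∀ x y : Coch k A B (m + 1), Coch.circ h₂ (((m : ℤ) - 1).negOnePow • x - y) g =
      ((m : ℤ) - 1).negOnePow • Coch.circ h₂ x g - Coch.circ h₂ y g := by
    intro x y
    simp only [← circHom_apply, map_sub, Units.smul_def, map_zsmul, AddMonoidHom.sub_apply,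
      AddMonoidHom.smul_apply]
  rw [d₁, d₂, a₁, a₂, a₃]
  have hN : (N : ℤ) = m + n - 1 := by omega
  rw [hN]
  rw [show ((n : ℤ) - 1) * (((2 : ℕ) : ℤ) - 1) = n - 1 by push_cast; ring,
    show (((2 : ℕ) : ℤ) - 1) * ((n : ℤ) - 1) = n - 1 by push_cast; ring,
    show ((m : ℤ) - 1) * ((n : ℤ) - 1) = m * n - m - n + 1 by ring,
    show ((m : ℤ) - 1) * n = m * n - n by ring, show ((n : ℤ) - 1) * m = m * n - m by ring]
  simp only [Int.negOnePow_sub, Int.negOnePow_add, Int.negOnePow_one]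
  -- All signs are now products of $(-1)^m$, $(-1)^n$ and $(-1)^{mn}$. These can be treated as
  -- independent: the identity holds for all eight choices.
  rcases Int.units_eq_one_or (m : ℤ).negOnePow with h₅ | h₅ <;>
  rcases Int.units_eq_one_or (n : ℤ).negOnePow with h₆ | h₆ <;>
  rcases Int.units_eq_one_or ((m : ℤ) * n).negOnePow with h₇ | h₇ <;>
  simp only [h₅, h₆, h₇, mul_one, mul_neg, neg_neg, Units.neg_smul, one_smul,
    smul_neg] <;> abel

/-- For `m = n = 0` the composite `f ∘ g` lies in degree `-1`, so the pre-Lie argument is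
unavailable. Here $\delta^\varepsilon f=\mu\circ_1 f-\mu\circ_0 f$, and inserting `g` gives the two
cup products directly, the first by the parallel axiom. -/
theorem Coch.circ_delta_of_zero (ε : B →ₐ[k] A) (hε : ∀ b, ε b ∈ Subalgebra.center k A)
    (f g : Coch k A B 0) (h : 0 + 1 = 1 + 0) :
    Coch.circ h (f.delta ε) g =
      Coch.cup ε rfl g f - (((0 : ℕ) : ℤ) * ((0 : ℕ) : ℤ)).negOnePow • Coch.cup ε rfl f g := by
  have h₁ : 1 + 1 = 2 + 0 := rfl
  have e : Coch.circ h (f.delta ε) g = Coch.circAt h 0 (f.delta ε) g := by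
    simp [Coch.circ]
  rw [e, Coch.cup_eq_circAt ε hε f g rfl h₁ h, Coch.cup_eq_circAt ε hε g f rfl h₁ h,
    Coch.circAt_circAt_of_lt h₁ h h₁ h 0 1 _ 0 (by decide) rfl rfl, Coch.delta,
    Coch.deltaFirst_eq_circAt ε hε f h₁, Coch.deltaLast_eq_circAt ε hε f h₁]
  simp only [← circAtHom_apply]
  simp [sub_eq_add_neg]

end Delta

/-! ### Extension to all integer degrees -/

section Graded

variable {k A B : Type*} [Field k] [Ring A] [Algebra k A] [CommRing B] [Algebra k B]

theorem circ_zero_left {m n p : ℤ} (h : p + 1 = m + n) (g : Cochain k A B n) :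
    circ h (0 : Cochain k A B m) g = 0 := by
  rcases m with m | m <;> rcases n with n | n <;> rcases p with p | p <;> try rfl
  have h' : p + 1 = m + n := by simp only [Int.ofNat_eq_natCast] at h; omega
  exact Coch.circ_zero_left h' (g : Coch k A B n)

theorem circ_zero_right {m n p : ℤ} (h : p + 1 = m + n) (f : Cochain k A B m) :
    circ h f (0 : Cochain k A B n) = 0 := by
  rcases m with m | m <;> rcases n with n | n <;> rcases p with p | p <;> try rfl
  have h' : p + 1 = m + n := by simp only [Int.ofNat_eq_natCast] at h; omega
  exact Coch.circ_zero_right h' (f : Coch k A B m)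

theorem delta_zero (ε : B →ₐ[k] A) (hε : ∀ b, ε b ∈ Subalgebra.center k A) {n p : ℤ}
    (h : n + 1 = p) : delta ε h (0 : Cochain k A B n) = 0 := by
  subst h
  rcases n with n | n
  · change Coch.delta ε (0 : Coch k A B n) = 0
    rw [Coch.delta_eq_circ ε hε _ rfl (by omega)]
    simp only [Coch.circ_zero_left, Coch.circ_zero_right, smul_zero, sub_zero]
  · rfl

theorem cup_of_neg_left (ε : B →ₐ[k] A) {m n p : ℤ} (hm : m < 0) (h : m + n = p)
    (f : Cochain k A B m) (g : Cochain k A B n) : cup ε h f g = 0 := by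
  rcases m with m | m
  · exact absurd hm (by simp)
  · rcases n with n | n <;> rcases p with p | p <;> rfl

theorem cup_of_neg_right (ε : B →ₐ[k] A) {m n p : ℤ} (hn : n < 0) (h : m + n = p)
    (f : Cochain k A B m) (g : Cochain k A B n) : cup ε h f g = 0 := by
  rcases n with n | n
  · exact absurd hn (by simp)
  · rcases m with m | m <;> rcases p with p | p <;> rfl

theorem Cochain.eq_zero_of_neg {n : ℤ} (hn : n < 0) (f : Cochain k A B n) : f = 0 := by
  rcases n with n | n
  · exact absurd hn (by simp)
  · rfl

/-- Keeping the degrees `p` and `q` as variables tied by equations permits case analysis on them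
without transport. For `m, n ≥ 0` the degree of `f ∘ g` is negative only if `m = n = 0`. -/
theorem circ_delta (ε : B →ₐ[k] A) (hε : ∀ b, ε b ∈ Subalgebra.center k A) {m n p q : ℤ}
    (h₁ : q + 1 = m + (n + 1)) (h₂ : p + 1 = m + n) (h₃ : p + 1 = q) (h₄ : q + 1 = m + 1 + n)
    (h₅ : n + m = q) (h₆ : m + n = q) (f : Cochain k A B m) (g : Cochain k A B n) :
    circ h₁ f (delta ε rfl g) - delta ε h₃ (circ h₂ f g) +
        (n - 1).negOnePow • circ h₄ (delta ε rfl f) g =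
      (n - 1).negOnePow • (cup ε h₅ g f - (m * n).negOnePow • cup ε h₆ f g) := by
  rcases lt_or_ge m 0 with hm | hm
  · rw [f.eq_zero_of_neg hm, cup_of_neg_left ε hm, cup_of_neg_right ε hm]
    simp only [circ_zero_left, delta_zero ε hε, smul_zero, sub_zero, add_zero]
  rcases lt_or_ge n 0 with hn | hn
  · rw [g.eq_zero_of_neg hn, cup_of_neg_left ε hn, cup_of_neg_right ε hn]
    simp only [circ_zero_right, delta_zero ε hε, smul_zero, sub_zero, add_zero]
  subst h₃
  rcases m with m | m
  · rcases n with n | n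
    · rcases p with p | p
      · exact Coch.circ_delta_of_succ ε hε (f : Coch k A B m) (g : Coch k A B n)
          (by simp only [Int.ofNat_eq_natCast] at h₂; omega)
          (by simp only [Int.ofNat_eq_natCast] at h₂; omega)
          (by simp only [Int.ofNat_eq_natCast] at h₂; omega)
          (by simp only [Int.ofNat_eq_natCast] at h₂; omega)
          (by simp only [Int.ofNat_eq_natCast] at h₂; omega)
      · simp only [Int.ofNat_eq_natCast, Int.negSucc_eq] at h₂
        obtain rfl : m = 0 := by omega
        obtain rfl : n = 0 := by omega
        obtain rfl : p = 0 := by omega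
        -- A cochain `f` of degree `0` has no slots, so this composition is an empty sum; the next
        -- one lies in degree `-1`.
        have e₁ : circ h₁ f (delta ε rfl g) = 0 := rfl
        have e₂ : circ h₂ f g = 0 := rfl
        rw [e₁, e₂, delta_zero ε hε, sub_zero, zero_add]
        congr 1
        exact Coch.circ_delta_of_zero ε hε (f : Coch k A B 0) (g : Coch k A B 0) rfl
    · exact absurd hn (by simp)
  · exact absurd hm (by simp)

end Graded

end SecondaryHochschild

theorem mainTheorem3 {k A B : Type*} [Field k] [Ring A] [Algebra k A] [CommRing B] [Algebra k B]
    (ε : B →ₐ[k] A) (hε : ∀ b : B, ε b ∈ Subalgebra.center k A)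
    (m n : ℤ) (f : SecondaryHochschild.Cochain k A B m) (g : SecondaryHochschild.Cochain k A B n) :
    (SecondaryHochschild.circ (by ring) f (SecondaryHochschild.delta ε rfl g) -
        SecondaryHochschild.delta ε (by ring)
          (SecondaryHochschild.circ (p := m + n - 1) (by ring) f g) +
        (n - 1).negOnePow •
          SecondaryHochschild.circ (by ring) (SecondaryHochschild.delta ε rfl f) g :
      SecondaryHochschild.Cochain k A B (m + n)) =
    (n - 1).negOnePow •
      (SecondaryHochschild.cup ε (by ring) g f -
        (m * n).negOnePow • SecondaryHochschild.cup ε rfl f g) :=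
  SecondaryHochschild.circ_delta ε hε _ _ _ _ _ _ f g
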